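/- Let $p\ge 0$ and $m\ge 1$ be integers, let $y_1,\dots,y_m,a,b\in\mathbb{R}^p$ and $M_y,\lambda\in\mathbb{R}$, and let $\|\cdot\|$ be the Euclidean norm. Suppose that $$\Big\|\sum_{i=k}^{l} y_i\Big\|\le M_y\sqrt{l-k+1}\qquad\text{for all }1\le k\le l\le m,$$ and that $25^2M_y\le\lambda<(7m-\sqrt m)M_y$. Let $(\hat x_1,\dots,\hat x_m)$ be the minimizer over $x_1,\dots,x_m\in\mathbb{R}^p$ of $$G(x_1,\dots,x_m)=\sum_{i=1}^m\|x_i-y_i\|^2+\lambda\Big(\|a-x_1\|+\|x_m-b\|+\sum_{i=1}^{m-1}\|x_i-x_{i+1}\|\Big).$$ Then for every $1\le i\le m-1$, $$\|\hat x_i\|\le\max\left(\frac{4(M_y\sqrt{m/2}+\lambda)}{m},\ \frac{50M_y}{\sqrt m},\ \frac{25\sqrt5\,M_y}{\sqrt i},\ \frac{25\sqrt5\,M_y}{\sqrt{m-i}},\ 125\sqrt{\frac{M_y^3}{\lambda}}\right).$$ (For $i=m$ the fourth term has denominator $0$ and is read as $+\infty$, so nothing is claimed.) -/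

import Mathlib

/-- The group fused lasso objective on one segment, with endpoint anchors `a` and `b`:
`G(x₁, …, xₘ) = ∑_{i=1}^m ‖xᵢ - yᵢ‖² + lam * (‖a - x₁‖ + ‖xₘ - b‖ + ∑_{i=1}^{m-1} ‖xᵢ - xᵢ₊₁‖)`.
The vectors are indexed from `1` to `m`, as usual; for `1 ≤ m` the entries of `x` and `y` at other
indices do not enter the value. -/
noncomputable def segmentObjective {p : ℕ} (m : ℕ) (lam : ℝ) (a b : EuclideanSpace ℝ (Fin p))
    (y x : ℕ → EuclideanSpace ℝ (Fin p)) : ℝ :=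
  (∑ i ∈ Finset.Icc 1 m, ‖x i - y i‖ ^ 2) +
    lam * (‖a - x 1‖ + ‖x m - b‖ + ∑ i ∈ Finset.Icc 1 (m - 1), ‖x i - x (i + 1)‖)

/-- `xhat₁, …, xhatₘ` minimizes the segment objective over all `x₁, …, xₘ` in `ℝᵖ`. -/
def IsSegmentMinimizer {p : ℕ} (m : ℕ) (lam : ℝ) (a b : EuclideanSpace ℝ (Fin p))
    (y xhat : ℕ → EuclideanSpace ℝ (Fin p)) : Prop :=
  ∀ x : ℕ → EuclideanSpace ℝ (Fin p),
    segmentObjective m lam a b y xhat ≤ segmentObjective m lam a b y x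

/-! Shifting blocks of the minimizer yields dual vectors `z j` in the unit ball whose increments are
`(2 / lam) • (x - y)`; each jump of `x` is a nonnegative multiple of `z j`, which then has norm one
(`IsSegmentMinimizer.exists_dual`). The anchors enter only through the triangle inequality, so they
disappear from the estimates.

At noise level one, pairing `x` with the increments of `z` gives an identity for the total variation
(`inner_sub_inner_eq`). Its term `∑ ‖x j‖ ^ 2` absorbs the noise, so on a window of length at most
`lam ^ 2 / 256` the variation is controlled by the inner products of `x` and `z` at the first and
last jump (`totalVariation_le`).

These boundary terms are bounded twice. Blocks of length one give a bound of order one, hence `‖x j‖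
≤ 10` (`norm_le_ten`). Then `z` turns slowly, so near a jump `x` is monotone in the direction of the
jump, and blocks of length `n` improve the bound to `1 / √n` (`neg_le_inner_left`,
`inner_right_le`). Thus `x i` is its mean over a central block, small by `norm_sum_le`, up to an
error of order `1 / √n` (`norm_le_interior`). The window around `i` and the scale `n` produce the
five terms of the maximum. -/

/-- Testing with small negative multiples of `w` makes the quadratic term negligible. This turns
variational inequalities into first order conditions. -/
theorem norm_le_of_forall_inner_add_nonneg {E : Type*} [NormedAddCommGroup E]
    [InnerProductSpace ℝ E] {w : E} {ρ C : ℝ} (hρ : 0 ≤ ρ)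
    (h : ∀ v : E, 0 ≤ inner ℝ w v + ρ * ‖v‖ + C * ‖v‖ ^ 2) : ‖w‖ ≤ ρ := by
  by_contra hc
  push Not at hc
  have hw : 0 < ‖w‖ := hρ.trans_lt hc
  have key : ∀ t : ℝ, 0 < t → ‖w‖ - ρ ≤ |C| * ‖w‖ * t := by
    intro t ht
    have h1 := h (-(t • w))
    rw [inner_neg_right, inner_smul_right, norm_neg, norm_smul, Real.norm_of_nonneg ht.le,
      real_inner_self_eq_norm_sq] at h1
    have h2 : C * (t * ‖w‖) ^ 2 ≤ |C| * (t * ‖w‖) ^ 2 := by gcongr; exact le_abs_self C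
    have h3 : t * ‖w‖ * (‖w‖ - ρ) ≤ t * ‖w‖ * (|C| * ‖w‖ * t) := by nlinarith
    exact le_of_mul_le_mul_left h3 (by positivity)
  have h1 := key ((‖w‖ - ρ) / (2 * (|C| + 1) * ‖w‖))
    (div_pos (by linarith) (by positivity))
  have h2 : |C| * ‖w‖ * ((‖w‖ - ρ) / (2 * (|C| + 1) * ‖w‖)) =
      (‖w‖ - ρ) * (|C| / (2 * (|C| + 1))) := by field_simp
  have h3 : |C| / (2 * (|C| + 1)) ≤ 1 / 2 := by
    rw [div_le_div_iff₀ (by positivity) (by positivity)]; linarith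
  rw [h2] at h1
  nlinarith

theorem norm_add_le_add_inner_add_sq {E : Type*} [NormedAddCommGroup E] [InnerProductSpace ℝ E]
    {d : E} (hd : d ≠ 0) (v : E) :
    ‖d + v‖ ≤ ‖d‖ + inner ℝ (‖d‖⁻¹ • d) v + 1 / (2 * ‖d‖) * ‖v‖ ^ 2 := by
  have hd' : 0 < ‖d‖ := norm_pos_iff.2 hd
  have h1 := norm_add_sq_real d v
  rw [inner_smul_left]
  simp only [conj_trivial]
  have h2 : ‖d‖ + ‖d‖⁻¹ * inner ℝ d v + 1 / (2 * ‖d‖) * ‖v‖ ^ 2 =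
      (‖d‖ ^ 2 + ‖d + v‖ ^ 2) / (2 * ‖d‖) := by
    rw [h1]; field_simp; ring
  rw [h2, le_div_iff₀ (by positivity)]
  nlinarith [sq_nonneg (‖d‖ - ‖d + v‖)]

/-! ### Stationarity under block shifts and the dual variables -/

section

open Finset

variable {p : ℕ} {m : ℕ} {lam : ℝ} {a b : EuclideanSpace ℝ (Fin p)}
  {y x : ℕ → EuclideanSpace ℝ (Fin p)}

/-- The sequence `a, x₁, …, xₘ, b, b, …`. -/
def anchored {E : Type*} (m : ℕ) (a b : E) (x : ℕ → E) (j : ℕ) : E :=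
  if j = 0 then a else if j ≤ m then x j else b

theorem anchored_of_mem {E : Type*} {m : ℕ} {a b : E} {x : ℕ → E} {j : ℕ} (h1 : 1 ≤ j)
    (h2 : j ≤ m) : anchored m a b x j = x j := by
  simp [anchored, h2, show j ≠ 0 by omega]

theorem segmentObjective_eq_anchored (hm : 1 ≤ m) :
    segmentObjective m lam a b y x = ∑ j ∈ Icc 1 m, ‖x j - y j‖ ^ 2 +
      lam * ∑ e ∈ range (m + 1), ‖anchored m a b x (e + 1) - anchored m a b x e‖ := by
  obtain ⟨m, rfl⟩ : ∃ k, m = k + 1 := ⟨m - 1, by omega⟩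
  unfold segmentObjective
  congr 2
  rw [sum_range_succ, sum_range_succ']
  have h1 : ∑ e ∈ range m, ‖anchored (m + 1) a b x (e + 1 + 1) - anchored (m + 1) a b x (e + 1)‖ =
      ∑ i ∈ Icc 1 (m + 1 - 1), ‖x i - x (i + 1)‖ := by
    rw [Nat.add_sub_cancel, ← Finset.Ico_add_one_right_eq_Icc, sum_Ico_eq_sum_range]
    refine sum_congr (by simp) fun e he => ?_
    rw [mem_range] at he
    rw [anchored_of_mem (by omega) (by omega), anchored_of_mem (by omega) (by omega), norm_sub_rev,
      add_comm 1 e]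
  rw [h1]
  simp [anchored]
  rw [norm_sub_rev a, norm_sub_rev b]
  ring

/-- Adding `v` on the block `(k, l]` alters only the two edges `k` and `l` of the penalty. The next
four results differ in which of these edges carries a jump, where the norm is differentiable, and
which is only bounded by the triangle inequality. -/
theorem IsSegmentMinimizer.variation_nonneg (h : IsSegmentMinimizer m lam a b y x) {k l : ℕ}
    (hkl : k < l) (hl : l ≤ m) (v : EuclideanSpace ℝ (Fin p)) :
    0 ≤ 2 * inner ℝ (∑ j ∈ Ioc k l, (x j - y j)) v + (l - k : ℕ) * ‖v‖ ^ 2 +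
      lam * ((‖anchored m a b x (k + 1) - anchored m a b x k + v‖ -
          ‖anchored m a b x (k + 1) - anchored m a b x k‖) +
        (‖anchored m a b x (l + 1) - anchored m a b x l - v‖ -
          ‖anchored m a b x (l + 1) - anchored m a b x l‖)) := by
  classical
  set X := anchored m a b x with hX
  set φ : ℕ → EuclideanSpace ℝ (Fin p) := fun j => if j ∈ Ioc k l then v else 0 with hφ
  have h1 := h fun j => x j + φ j
  rw [segmentObjective_eq_anchored (by omega), segmentObjective_eq_anchored (by omega)] at h1
  have h2 : ∀ j, anchored m a b (fun j => x j + φ j) j = X j + φ j := by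
    intro j
    simp only [anchored, hX, hφ, mem_Ioc]
    split_ifs <;> first | omega | simp
  have h3 : ∑ j ∈ Icc 1 m, ‖x j + φ j - y j‖ ^ 2 = ∑ j ∈ Icc 1 m, ‖x j - y j‖ ^ 2 +
      (2 * inner ℝ (∑ j ∈ Ioc k l, (x j - y j)) v + (l - k : ℕ) * ‖v‖ ^ 2) := by
    have h4 : ∀ j, ‖x j + φ j - y j‖ ^ 2 = ‖x j - y j‖ ^ 2 +
        if j ∈ Ioc k l then 2 * inner ℝ (x j - y j) v + ‖v‖ ^ 2 else 0 := by
      intro j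
      simp only [hφ]
      split_ifs
      · rw [add_sub_right_comm, norm_add_sq_real]; ring
      · simp
    have h5 : (Icc 1 m).filter (· ∈ Ioc k l) = Ioc k l := by
      ext j; simp only [mem_filter, mem_Icc, mem_Ioc]; omega
    rw [sum_congr rfl fun j _ => h4 j, sum_add_distrib, ← sum_filter, h5, sum_add_distrib,
      ← mul_sum, ← sum_inner]
    simp
  have h6 : ∑ e ∈ range (m + 1), ‖X (e + 1) + φ (e + 1) - (X e + φ e)‖ =
      ∑ e ∈ range (m + 1), ‖X (e + 1) - X e‖ +
      ((‖X (k + 1) - X k + v‖ - ‖X (k + 1) - X k‖) +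
        (‖X (l + 1) - X l - v‖ - ‖X (l + 1) - X l‖)) := by
    rw [← sub_eq_iff_eq_add', ← sum_sub_distrib]
    have h7 : ({k, l} : Finset ℕ) ⊆ range (m + 1) := by
      intro e; simp only [mem_insert, mem_singleton, mem_range]; omega
    rw [← sum_subset h7, sum_pair hkl.ne]
    · simp only [hφ, mem_Ioc]
      rw [if_pos (by omega), if_neg (by omega), if_neg (by omega), if_pos (by omega)]
      rw [show X (k + 1) + v - (X k + 0) = X (k + 1) - X k + v by abel,
        show X (l + 1) + 0 - (X l + v) = X (l + 1) - X l - v by abel]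
    · intro e _ he
      simp only [mem_insert, mem_singleton, not_or] at he
      simp only [hφ, mem_Ioc]
      by_cases h8 : k < e ∧ e ≤ l
      · rw [if_pos h8, if_pos (by omega)]; simp
      · rw [if_neg h8, if_neg (by omega)]; simp
  simp only [h2, h3, h6] at h1
  linarith

theorem IsSegmentMinimizer.norm_sum_sub_le (h : IsSegmentMinimizer m lam a b y x)
    (hlam : 0 < lam) {k l : ℕ} (hkl : k < l) (hl : l ≤ m) :
    ‖∑ j ∈ Ioc k l, (x j - y j)‖ ≤ lam := by
  refine norm_le_of_forall_inner_add_nonneg (C := (l - k : ℕ) / 2) hlam.le fun v => ?_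
  have h1 := h.variation_nonneg hkl hl v
  have h2 := norm_add_le (anchored m a b x (k + 1) - anchored m a b x k) v
  have h3 := norm_sub_le (anchored m a b x (l + 1) - anchored m a b x l) v
  nlinarith

theorem IsSegmentMinimizer.norm_sum_add_le_of_jump_left (h : IsSegmentMinimizer m lam a b y x)
    (hlam : 0 < lam) {k l : ℕ} (hk : 1 ≤ k) (hkl : k < l) (hl : l ≤ m) (hd : x (k + 1) - x k ≠ 0) :
    ‖(2 : ℝ) • ∑ j ∈ Ioc k l, (x j - y j) + lam • (‖x (k + 1) - x k‖⁻¹ • (x (k + 1) - x k))‖ ≤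
      lam := by
  refine norm_le_of_forall_inner_add_nonneg
    (C := (l - k : ℕ) + lam * (1 / (2 * ‖x (k + 1) - x k‖))) hlam.le fun v => ?_
  have h1 := h.variation_nonneg hkl hl v
  rw [anchored_of_mem (j := k) hk (by omega), anchored_of_mem (j := k + 1) (by omega) (by omega)]
    at h1
  have h2 := norm_add_le_add_inner_add_sq hd v
  have h3 := norm_sub_le (anchored m a b x (l + 1) - anchored m a b x l) v
  rw [inner_add_left, inner_smul_left _ _ (2 : ℝ), inner_smul_left _ _ lam]
  simp only [conj_trivial]
  nlinarith

theorem IsSegmentMinimizer.norm_sum_sub_le_of_jump_right (h : IsSegmentMinimizer m lam a b y x)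
    (hlam : 0 < lam) {k l : ℕ} (hkl : k < l) (hl : l < m) (hd : x (l + 1) - x l ≠ 0) :
    ‖(2 : ℝ) • ∑ j ∈ Ioc k l, (x j - y j) - lam • (‖x (l + 1) - x l‖⁻¹ • (x (l + 1) - x l))‖ ≤
      lam := by
  refine norm_le_of_forall_inner_add_nonneg
    (C := (l - k : ℕ) + lam * (1 / (2 * ‖x (l + 1) - x l‖))) hlam.le fun v => ?_
  have h1 := h.variation_nonneg hkl hl.le v
  rw [anchored_of_mem (j := l) (by omega) (by omega),
    anchored_of_mem (j := l + 1) (by omega) (by omega)] at h1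
  have h2 := norm_add_le_add_inner_add_sq hd (-v)
  rw [← sub_eq_add_neg, inner_neg_right, norm_neg] at h2
  have h3 := norm_add_le (anchored m a b x (k + 1) - anchored m a b x k) v
  rw [inner_sub_left, inner_smul_left _ _ (2 : ℝ), inner_smul_left _ _ lam]
  simp only [conj_trivial]
  nlinarith

theorem IsSegmentMinimizer.sum_add_eq_of_jumps (h : IsSegmentMinimizer m lam a b y x)
    (hlam : 0 < lam) {k l : ℕ} (hk : 1 ≤ k) (hkl : k < l) (hl : l < m) (hdk : x (k + 1) - x k ≠ 0)
    (hdl : x (l + 1) - x l ≠ 0) :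
    (2 : ℝ) • ∑ j ∈ Ioc k l, (x j - y j) + lam • (‖x (k + 1) - x k‖⁻¹ • (x (k + 1) - x k)) =
      lam • (‖x (l + 1) - x l‖⁻¹ • (x (l + 1) - x l)) := by
  rw [← sub_eq_zero, ← norm_le_zero_iff]
  refine norm_le_of_forall_inner_add_nonneg
    (C := (l - k : ℕ) + lam * (1 / (2 * ‖x (k + 1) - x k‖) + 1 / (2 * ‖x (l + 1) - x l‖)))
    le_rfl fun v => ?_
  have h1 := h.variation_nonneg hkl hl.le v
  rw [anchored_of_mem (j := l) (by omega) (by omega), anchored_of_mem (j := k) (by omega) (by omega),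
    anchored_of_mem (j := k + 1) (by omega) (by omega),
    anchored_of_mem (j := l + 1) (by omega) (by omega)] at h1
  have h2 := norm_add_le_add_inner_add_sq hdl (-v)
  rw [← sub_eq_add_neg, inner_neg_right, norm_neg] at h2
  have h3 := norm_add_le_add_inner_add_sq hdk v
  rw [inner_sub_left, inner_add_left, inner_smul_left _ _ (2 : ℝ), inner_smul_left _ _ lam,
    inner_smul_left _ _ lam]
  simp only [conj_trivial]
  nlinarith

theorem inner_normalize_self {E : Type*} [NormedAddCommGroup E] [InnerProductSpace ℝ E] (d : E) :
    inner ℝ d (‖d‖⁻¹ • d) = ‖d‖ := by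
  rw [inner_smul_right, real_inner_self_eq_norm_sq]
  rcases eq_or_ne ‖d‖ 0 with h | h
  · simp [h]
  · field_simp

theorem IsSegmentMinimizer.exists_dual (h : IsSegmentMinimizer m lam a b y x) (hlam : 0 < lam)
    {e : ℕ} (he1 : 1 ≤ e) (hem : e < m) (hd : x (e + 1) ≠ x e) :
    ∃ z : ℕ → EuclideanSpace ℝ (Fin p), (∀ j, j ≤ m → ‖z j‖ ≤ 1) ∧
      (∀ j, j < m → x (j + 1) - y (j + 1) = (lam / 2) • (z (j + 1) - z j)) ∧
      ∀ j, 1 ≤ j → j < m → inner ℝ (x (j + 1) - x j) (z j) = ‖x (j + 1) - x j‖ := by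
  have hd' := sub_ne_zero.2 hd
  set u := ‖x (e + 1) - x e‖⁻¹ • (x (e + 1) - x e) with hu
  set P : ℕ → EuclideanSpace ℝ (Fin p) := fun l => ∑ j ∈ Ioc 0 l, (x j - y j) with hP
  have hPsub : ∀ k l, k ≤ l → ∑ j ∈ Ioc k l, (x j - y j) = P l - P k := by
    intro k l hkl
    rw [eq_sub_iff_add_eq', hP]
    exact sum_Ioc_consecutive (fun j => x j - y j) (Nat.zero_le k) hkl
  have hu1 : ‖u‖ = 1 := by
    rw [hu, norm_smul, norm_inv, norm_norm, inv_mul_cancel₀ (norm_ne_zero_iff.2 hd')]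
  have hscale : ∀ w : EuclideanSpace ℝ (Fin p), u + (2 / lam) • w = lam⁻¹ • ((2 : ℝ) • w + lam • u) := by
    intro w
    rw [smul_add, smul_smul, smul_smul, inv_mul_cancel₀ hlam.ne', one_smul, add_comm]
    congr 2; field_simp
  -- The increments fix `z` up to a constant, and the known jump at `e` fixes the constant by `z e =
  -- u`.
  refine ⟨fun l => u + (2 / lam) • (P l - P e), ?_, ?_, ?_⟩
  · intro j hj
    simp only
    have hle : ∀ w : EuclideanSpace ℝ (Fin p), ‖w‖ ≤ lam → ‖lam⁻¹ • w‖ ≤ 1 := by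
      intro w hw
      rw [norm_smul, Real.norm_of_nonneg (by positivity), inv_mul_le_iff₀ hlam]; linarith
    rcases lt_trichotomy j e with hje | rfl | hje
    · rw [hscale]
      apply hle
      have := h.norm_sum_sub_le_of_jump_right hlam hje hem hd'
      rw [hPsub _ _ hje.le, ← hu, ← norm_neg] at this
      rwa [show (2 : ℝ) • (P j - P e) + lam • u = -((2 : ℝ) • (P e - P j) - lam • u) by module]
    · simp [hu1]
    · rw [hscale]
      apply hle
      have := h.norm_sum_add_le_of_jump_left hlam he1 hje hj hd'
      rwa [hPsub _ _ hje.le, ← hu] at this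
  · intro j hj
    have h1 : P (j + 1) = P j + (x (j + 1) - y (j + 1)) := by
      simp only [hP]; rw [sum_Ioc_succ_top (by omega)]
    have h2 : lam / 2 * (2 / lam) = 1 := by field_simp
    simp only
    rw [add_sub_add_left_eq_sub, ← smul_sub, smul_smul, h2, one_smul, h1]
    abel
  · intro j hj hjm
    by_cases hj0 : x (j + 1) - x j = 0
    · simp [hj0]
    · suffices hz : u + (2 / lam) • (P j - P e) = ‖x (j + 1) - x j‖⁻¹ • (x (j + 1) - x j) by
        simp only [hz]; exact inner_normalize_self _
      have hinv : ∀ w : EuclideanSpace ℝ (Fin p), lam⁻¹ • (lam • w) = w := fun w => by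
        rw [smul_smul, inv_mul_cancel₀ hlam.ne', one_smul]
      rcases lt_trichotomy j e with hje | rfl | hje
      · have := h.sum_add_eq_of_jumps hlam hj hje hem hj0 hd'
        rw [hPsub _ _ hje.le, ← hu] at this
        rw [hscale, ← hinv (‖x (j + 1) - x j‖⁻¹ • (x (j + 1) - x j)), ← this]
        congr 1
        module
      · simp [hu]
      · have := h.sum_add_eq_of_jumps hlam he1 hje hjm hd' hj0
        rw [hPsub _ _ hje.le, ← hu] at this
        rw [hscale, this, hinv]

end

/-! ### Windows at noise level one: block sums and the variation identity -/

open Finset in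
theorem sum_Ioc_sub_eq_smul_sub {E : Type*} [AddCommGroup E] [Module ℝ E] {x y z : ℕ → E}
    {c : ℝ} {p q : ℕ} (h : ∀ j, p ≤ j → j < q → x (j + 1) - y (j + 1) = c • (z (j + 1) - z j))
    {k l : ℕ} (hk : p ≤ k) (hkl : k ≤ l) (hl : l ≤ q) :
    ∑ j ∈ Ioc k l, (x j - y j) = c • (z l - z k) := by
  induction l, hkl using Nat.le_induction with
  | base => simp
  | succ l hkl ih =>
    rw [sum_Ioc_succ_top (by omega), ih (by omega), h l (by omega) (by omega), ← smul_add]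
    congr 1; abel

theorem eq_norm_smul_of_inner_eq_norm {E : Type*} [NormedAddCommGroup E] [InnerProductSpace ℝ E]
    {d u : E} (hu : ‖u‖ ≤ 1) (h : inner ℝ d u = ‖d‖) : d = ‖d‖ • u := by
  have h1 : ‖d - ‖d‖ • u‖ ^ 2 = ‖d‖ ^ 2 * (‖u‖ ^ 2 - 1) := by
    rw [norm_sub_sq_real, inner_smul_right, h, norm_smul, norm_norm]; ring
  have h2 : ‖d - ‖d‖ • u‖ ^ 2 ≤ 0 := by
    rw [h1]
    have : ‖u‖ ^ 2 ≤ 1 := by nlinarith [norm_nonneg u]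
    nlinarith [sq_nonneg ‖d‖]
  have h3 : ‖d - ‖d‖ • u‖ = 0 := by nlinarith [norm_nonneg (d - ‖d‖ • u)]
  exact sub_eq_zero.1 (norm_eq_zero.1 h3)

theorem norm_eq_one_of_inner_eq_norm {E : Type*} [NormedAddCommGroup E] [InnerProductSpace ℝ E]
    {d u : E} (hu : ‖u‖ ≤ 1) (hd : d ≠ 0) (h : inner ℝ d u = ‖d‖) : ‖u‖ = 1 := by
  have h1 := eq_norm_smul_of_inner_eq_norm hu h
  have h2 : ‖d‖ = ‖d‖ * ‖u‖ := by
    conv_lhs => rw [h1, norm_smul, norm_norm]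
  have h3 : ‖d‖ ≠ 0 := norm_ne_zero_iff.2 hd
  field_simp at h2
  exact h2.symm

/-- First order conditions of the group fused lasso with penalty `lam` on the window `(p, q]`, with
dual variables `z`, for data `y` whose partial sums have the size of those of standard noise. -/
structure FusedLassoWindow {E : Type*} [NormedAddCommGroup E] [InnerProductSpace ℝ E]
    (lam : ℝ) (p q : ℕ) (x y z : ℕ → E) : Prop where
  lam_pos : 0 < lam
  norm_dual_le : ∀ j, p ≤ j → j ≤ q → ‖z j‖ ≤ 1
  sub_eq : ∀ j, p ≤ j → j < q → x (j + 1) - y (j + 1) = (lam / 2) • (z (j + 1) - z j)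
  inner_jump : ∀ j, p < j → j < q → inner ℝ (x (j + 1) - x j) (z j) = ‖x (j + 1) - x j‖
  noise_le : ∀ k l, p ≤ k → k ≤ l → l ≤ q → ‖∑ j ∈ Finset.Ioc k l, y j‖ ≤ √((l : ℝ) - k)

namespace FusedLassoWindow

open Finset

variable {E : Type*} [NormedAddCommGroup E] [InnerProductSpace ℝ E] {lam : ℝ} {p q : ℕ}
  {x y z : ℕ → E}

theorem mono (h : FusedLassoWindow lam p q x y z) {p' q' : ℕ} (hp : p ≤ p') (hq : q' ≤ q) :
    FusedLassoWindow lam p' q' x y z where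
  lam_pos := h.lam_pos
  norm_dual_le j h1 h2 := h.norm_dual_le j (by omega) (by omega)
  sub_eq j h1 h2 := h.sub_eq j (by omega) (by omega)
  inner_jump j h1 h2 := h.inner_jump j (by omega) (by omega)
  noise_le k l h1 h2 h3 := h.noise_le k l (by omega) h2 (by omega)

theorem sum_sub (h : FusedLassoWindow lam p q x y z) {k l : ℕ} (hk : p ≤ k) (hkl : k ≤ l)
    (hl : l ≤ q) : ∑ j ∈ Ioc k l, (x j - y j) = (lam / 2) • (z l - z k) :=
  sum_Ioc_sub_eq_smul_sub h.sub_eq hk hkl hl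

theorem norm_sum_le (h : FusedLassoWindow lam p q x y z) {k l : ℕ} (hk : p ≤ k) (hkl : k ≤ l)
    (hl : l ≤ q) : ‖∑ j ∈ Ioc k l, x j‖ ≤ lam + √((l : ℝ) - k) := by
  have h1 := h.sum_sub hk hkl hl
  rw [sum_sub_distrib, sub_eq_iff_eq_add] at h1
  rw [h1]
  have h2 := h.lam_pos
  have h3 : ‖z l - z k‖ ≤ 2 := by
    have := norm_sub_le (z l) (z k)
    have := h.norm_dual_le l (by omega) (by omega)
    have := h.norm_dual_le k (by omega) (by omega)
    linarith
  refine (norm_add_le _ _).trans (add_le_add ?_ (h.noise_le k l hk hkl hl))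
  rw [norm_smul, Real.norm_of_nonneg (by positivity)]
  nlinarith

theorem norm_dual_eq_one (h : FusedLassoWindow lam p q x y z) {j : ℕ} (hpj : p < j) (hjq : j < q)
    (hj : x (j + 1) ≠ x j) : ‖z j‖ = 1 :=
  norm_eq_one_of_inner_eq_norm (h.norm_dual_le j hpj.le hjq.le) (sub_ne_zero.2 hj)
    (h.inner_jump j hpj hjq)

theorem sub_eq_norm_smul (h : FusedLassoWindow lam p q x y z) {j : ℕ} (hpj : p < j)
    (hjq : j < q) : x (j + 1) - x j = ‖x (j + 1) - x j‖ • z j :=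
  eq_norm_smul_of_inner_eq_norm (h.norm_dual_le j hpj.le hjq.le) (h.inner_jump j hpj hjq)

/-- Since `z j` is a unit vector and `z k` lies in the unit ball, `z j - z k` pairs nonnegatively
with `z j`; only the noise can make the sum negative, and `lam` drops out. -/
theorem neg_sqrt_le_sum_inner (h : FusedLassoWindow lam p q x y z) {k j : ℕ} (hk : p ≤ k)
    (hkj : k ≤ j) (hjq : j ≤ q) (hz : ‖z j‖ = 1) :
    -√((j : ℝ) - k) ≤ ∑ i ∈ Ioc k j, inner ℝ (x i) (z j) := by
  have h1 := congrArg (fun v => inner ℝ v (z j)) (h.sum_sub hk hkj hjq)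
  simp only [sum_sub_distrib, inner_sub_left, inner_smul_left, real_inner_self_eq_norm_sq, hz,
    sum_inner] at h1
  have h2 : |inner ℝ (z k) (z j)| ≤ 1 := by
    refine (abs_real_inner_le_norm _ _).trans ?_
    rw [hz, mul_one]; exact h.norm_dual_le k hk (by omega)
  have h3 : |inner ℝ (∑ i ∈ Ioc k j, y i) (z j)| ≤ √((j : ℝ) - k) := by
    refine (abs_real_inner_le_norm _ _).trans ?_
    rw [hz, mul_one]; exact h.noise_le k j hk hkj hjq
  rw [sum_inner] at h3
  have h4 := h.lam_pos
  have h5 : 0 ≤ lam / 2 * (1 - inner ℝ (z k) (z j)) :=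
    mul_nonneg (by positivity) (by linarith [(abs_le.1 h2).2])
  simp at h1
  linarith [(abs_le.1 h3).1]

theorem sum_inner_le_sqrt (h : FusedLassoWindow lam p q x y z) {j l : ℕ} (hj : p ≤ j)
    (hjl : j ≤ l) (hlq : l ≤ q) (hz : ‖z j‖ = 1) :
    ∑ i ∈ Ioc j l, inner ℝ (x i) (z j) ≤ √((l : ℝ) - j) := by
  have h1 := congrArg (fun v => inner ℝ v (z j)) (h.sum_sub hj hjl hlq)
  simp only [sum_sub_distrib, inner_sub_left, inner_smul_left, real_inner_self_eq_norm_sq, hz,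
    sum_inner] at h1
  have h2 : |inner ℝ (z l) (z j)| ≤ 1 := by
    refine (abs_real_inner_le_norm _ _).trans ?_
    rw [hz, mul_one]; exact h.norm_dual_le l (by omega) (by omega)
  have h3 : |inner ℝ (∑ i ∈ Ioc j l, y i) (z j)| ≤ √((l : ℝ) - j) := by
    refine (abs_real_inner_le_norm _ _).trans ?_
    rw [hz, mul_one]; exact h.noise_le j l hj hjl hlq
  rw [sum_inner] at h3
  have h4 := h.lam_pos
  have h5 : 0 ≤ lam / 2 * (1 - inner ℝ (z l) (z j)) :=
    mul_nonneg (by positivity) (by linarith [(abs_le.1 h2).2])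
  simp at h1
  linarith [(abs_le.1 h3).2]

/-- Summation by parts: the change of `x` against `z` gives the jump sizes, the change of `z` gives
the residuals. -/
theorem inner_sub_inner_eq (h : FusedLassoWindow lam p q x y z) {s t : ℕ} (hs : p < s)
    (hst : s ≤ t) (ht : t < q) :
    inner ℝ (x (t + 1)) (z t) - inner ℝ (x s) (z s) =
      ∑ j ∈ Icc s t, ‖x (j + 1) - x j‖ + 2 / lam * ∑ j ∈ Ioc s t, inner ℝ (x j) (x j - y j) := by
  have hl := h.lam_pos
  induction t, hst using Nat.le_induction with
  | base => simp [← h.inner_jump s hs ht, inner_sub_left]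
  | succ t hst ih =>
    rw [sum_Icc_succ_top (by omega), sum_Ioc_succ_top (by omega), h.sub_eq t (by omega) (by omega),
      ← h.inner_jump (t + 1) (by omega) ht, mul_add]
    have := ih (by omega)
    have h2 : 2 / lam * inner ℝ (x (t + 1)) ((lam / 2) • (z (t + 1) - z t)) =
        inner ℝ (x (t + 1)) (z (t + 1)) - inner ℝ (x (t + 1)) (z t) := by
      rw [inner_smul_right, inner_sub_right]; field_simp
    rw [h2, inner_sub_left]
    linarith

end FusedLassoWindow

/-! ### Total variation controlled by boundary terms -/

open Finset in
theorem sum_Ioc_inner_by_parts {E : Type*} [NormedAddCommGroup E] [InnerProductSpace ℝ E]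
    (x y : ℕ → E) {s t : ℕ} (hst : s ≤ t) :
    ∑ j ∈ Ioc s t, inner ℝ (x j) (y j) = inner ℝ (x (t + 1)) (∑ j ∈ Ioc s t, y j) -
      ∑ j ∈ Ioc s t, inner ℝ (x (j + 1) - x j) (∑ i ∈ Ioc s j, y i) := by
  induction t, hst using Nat.le_induction with
  | base => simp
  | succ t hst ih =>
    rw [sum_Ioc_succ_top (by omega), ih, sum_Ioc_succ_top (b := t) (by omega),
      sum_Ioc_succ_top (b := t) (by omega), inner_sub_left, sum_Ioc_succ_top (b := t) (by omega),
      inner_add_right, inner_add_right]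
    ring

open Finset in
theorem norm_sub_le_sum_Icc {E : Type*} [SeminormedAddCommGroup E] (x : ℕ → E) {u v i j : ℕ}
    (hi : u ≤ i) (hij : i ≤ j) (hj : j ≤ v + 1) :
    ‖x j - x i‖ ≤ ∑ e ∈ Icc u v, ‖x (e + 1) - x e‖ := by
  rw [← sum_Ico_sub x hij]
  refine (norm_sum_le _ _).trans (sum_le_sum_of_subset_of_nonneg ?_ fun _ _ _ => norm_nonneg _)
  intro e he
  simp only [mem_Ico, mem_Icc] at he ⊢
  omega

namespace FusedLassoWindow

open Finset

variable {E : Type*} [NormedAddCommGroup E] [InnerProductSpace ℝ E] {lam : ℝ} {p q : ℕ}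
  {x y z : ℕ → E}

theorem sum_inner_noise_le (h : FusedLassoWindow lam p q x y z) {s t : ℕ} (hs : p < s)
    (hst : s ≤ t) (ht : t < q) :
    ∑ j ∈ Ioc s t, inner ℝ (x j) (y j) ≤ ∑ j ∈ Ioc s t, ‖x j‖ ^ 2 + 1 / 4 +
      2 * √((t : ℝ) - s) * ∑ j ∈ Icc s t, ‖x (j + 1) - x j‖ := by
  set r := √((t : ℝ) - s) with hr
  set T := ∑ j ∈ Icc s t, ‖x (j + 1) - x j‖ with hT
  have hr0 : 0 ≤ r := Real.sqrt_nonneg _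
  have hY : ∀ j ∈ Ioc s t, ‖∑ i ∈ Ioc s j, y i‖ ≤ r := by
    intro j hj
    rw [mem_Ioc] at hj
    refine (h.noise_le s j hs.le hj.1.le (by omega)).trans (Real.sqrt_le_sqrt ?_)
    have : (j : ℝ) ≤ t := by exact_mod_cast hj.2
    linarith
  have hYt : ‖∑ i ∈ Ioc s t, y i‖ ≤ r := h.noise_le s t hs.le hst ht.le
  rw [sum_Ioc_inner_by_parts x y hst]
  have h1 : inner ℝ (x (t + 1)) (∑ j ∈ Ioc s t, y j) ≤ r * ‖x (t + 1)‖ := by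
    refine (real_inner_le_norm _ _).trans ?_
    rw [mul_comm]; gcongr
  have h2 : -∑ j ∈ Ioc s t, inner ℝ (x (j + 1) - x j) (∑ i ∈ Ioc s j, y i) ≤ r * T := by
    rw [← sum_neg_distrib]
    calc _ ≤ ∑ j ∈ Ioc s t, r * ‖x (j + 1) - x j‖ := by
          refine sum_le_sum fun j hj => ?_
          rw [← inner_neg_left]
          refine (real_inner_le_norm _ _).trans ?_
          rw [norm_neg, mul_comm]
          gcongr
          exact hY j hj
      _ ≤ r * T := by
          rw [← mul_sum]
          refine mul_le_mul_of_nonneg_left ?_ hr0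
          exact sum_le_sum_of_subset_of_nonneg Ioc_subset_Icc_self fun _ _ _ => norm_nonneg _
  have h3 : r * ‖x (t + 1)‖ ≤ ∑ j ∈ Ioc s t, ‖x j‖ ^ 2 + 1 / 4 + r * T := by
    rcases hr0.eq_or_lt with h0 | h0
    · rw [← h0]
      have : 0 ≤ ∑ j ∈ Ioc s t, ‖x j‖ ^ 2 := sum_nonneg fun _ _ => by positivity
      linarith
    · have hcard : (#(Ioc s t) : ℝ) = r ^ 2 := by
        rw [Nat.card_Ioc, Nat.cast_sub hst, hr, Real.sq_sqrt]
        have : (s : ℝ) ≤ t := by exact_mod_cast hst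
        linarith
      -- The end value is averaged over the `r ^ 2` indices of the block: each `‖x j‖ / r` is at
      -- most `‖x j‖ ^ 2 + 1 / (4 * r ^ 2)`, which sums to the constant `1 / 4`.
      have h4 : ∑ j ∈ Ioc s t, ‖x (t + 1)‖ / r ≤
          ∑ j ∈ Ioc s t, (‖x j‖ ^ 2 + (1 / (4 * r ^ 2) + T / r)) := by
        refine sum_le_sum fun j hj => ?_
        rw [mem_Ioc] at hj
        have h5 : ‖x (t + 1) - x j‖ ≤ T := norm_sub_le_sum_Icc x (by omega) (by omega) le_rfl
        have h6 : ‖x (t + 1)‖ ≤ ‖x j‖ + T := by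
          have := norm_sub_norm_le (x (t + 1)) (x j)
          linarith
        have h7 : ‖x (t + 1)‖ / r ≤ ‖x j‖ / r + T / r := by
          rw [← add_div]; gcongr
        have h8 : ‖x j‖ ^ 2 + 1 / (4 * r ^ 2) - ‖x j‖ / r = (‖x j‖ - 1 / (2 * r)) ^ 2 := by
          field_simp; ring
        nlinarith [sq_nonneg (‖x j‖ - 1 / (2 * r))]
      rw [sum_add_distrib, sum_const, sum_const, nsmul_eq_mul, nsmul_eq_mul, hcard] at h4
      have h9 : r ^ 2 * (‖x (t + 1)‖ / r) = r * ‖x (t + 1)‖ := by field_simp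
      have h10 : r ^ 2 * (1 / (4 * r ^ 2) + T / r) = 1 / 4 + r * T := by field_simp
      linarith
  linarith

theorem totalVariation_le_inner (h : FusedLassoWindow lam p q x y z) {s t : ℕ} (hs : p < s)
    (hst : s ≤ t) (ht : t < q) :
    (1 - 4 * √((t : ℝ) - s) / lam) * ∑ j ∈ Icc s t, ‖x (j + 1) - x j‖ ≤
      inner ℝ (x (t + 1)) (z t) - inner ℝ (x s) (z s) + 1 / (2 * lam) := by
  have hl := h.lam_pos
  rw [h.inner_sub_inner_eq hs hst ht]
  simp only [inner_sub_right, real_inner_self_eq_norm_sq, sum_sub_distrib]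
  have h1 := h.sum_inner_noise_le hs hst ht
  set T := ∑ j ∈ Icc s t, ‖x (j + 1) - x j‖
  have h2 : 2 / lam * (∑ j ∈ Ioc s t, inner ℝ (x j) (y j) - ∑ j ∈ Ioc s t, ‖x j‖ ^ 2) ≤
      2 / lam * (1 / 4 + 2 * √((t : ℝ) - s) * T) := by
    gcongr; linarith
  have h3 : 2 / lam * (1 / 4 + 2 * √((t : ℝ) - s) * T) =
      1 / (2 * lam) + 4 * √((t : ℝ) - s) / lam * T := by
    field_simp; ring
  linarith

theorem totalVariation_le (h : FusedLassoWindow lam p q x y z)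
    (hL : (q : ℝ) - p ≤ lam ^ 2 / 256) {u v : ℕ} (hu : p < u) (hv : v < q) {δ : ℝ} (hδ : 0 ≤ δ)
    (hleft : ∀ j, u ≤ j → j ≤ v → x (j + 1) ≠ x j → -δ ≤ inner ℝ (x j) (z j))
    (hright : ∀ j, u ≤ j → j ≤ v → x (j + 1) ≠ x j → inner ℝ (x (j + 1)) (z j) ≤ δ) :
    ∑ j ∈ Icc u v, ‖x (j + 1) - x j‖ ≤ 4 / 3 * (2 * δ + 1 / (2 * lam)) := by
  classical
  have hl := h.lam_pos
  -- The sum is cut to the range from first to last jump, because the boundary terms are only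
  -- controlled at jumps.
  set J := (Icc u v).filter fun j => x (j + 1) ≠ x j with hJ
  rcases J.eq_empty_or_nonempty with he | hne
  · rw [sum_eq_zero]
    · positivity
    · intro j hj
      by_contra hc
      have : j ∈ J := mem_filter.2 ⟨hj, fun h0 => hc (by simp [h0])⟩
      simp [he] at this
  · set s := J.min' hne
    set t := J.max' hne
    have hsJ := mem_filter.1 (J.min'_mem hne)
    have htJ := mem_filter.1 (J.max'_mem hne)
    have hst : s ≤ t := J.min'_le_max' hne
    obtain ⟨hs1, hs2⟩ := mem_Icc.1 hsJ.1
    obtain ⟨ht1, ht2⟩ := mem_Icc.1 htJ.1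
    have hsum : ∑ j ∈ Icc u v, ‖x (j + 1) - x j‖ = ∑ j ∈ Icc s t, ‖x (j + 1) - x j‖ := by
      symm
      refine sum_subset (Icc_subset_Icc hs1 ht2) fun j hj hj' => ?_
      by_contra hc
      have hjJ : j ∈ J := mem_filter.2 ⟨hj, fun h0 => hc (by simp [h0])⟩
      exact hj' (mem_Icc.2 ⟨J.min'_le j hjJ, J.le_max' j hjJ⟩)
    rw [hsum]
    have h1 := h.totalVariation_le_inner (s := s) (t := t) (by omega) hst (by omega)
    have h2 := hleft s hs1 hs2 hsJ.2
    have h3 := hright t ht1 ht2 htJ.2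
    have h4 : √((t : ℝ) - s) ≤ lam / 16 := by
      refine Real.sqrt_le_iff.2 ⟨by positivity, ?_⟩
      have : (t : ℝ) ≤ q := by exact_mod_cast (by omega : t ≤ q)
      have : (p : ℝ) ≤ s := by exact_mod_cast (by omega : p ≤ s)
      nlinarith
    have h5 : 4 * √((t : ℝ) - s) / lam ≤ 1 / 4 := by
      rw [div_le_iff₀ hl]; linarith
    have h6 : 0 ≤ ∑ j ∈ Icc s t, ‖x (j + 1) - x j‖ := sum_nonneg fun _ _ => norm_nonneg _
    nlinarith

theorem norm_le_mean_add (h : FusedLassoWindow lam p q x y z) {k l j : ℕ} (hk : p ≤ k)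
    (hkl : k < l) (hl : l ≤ q) {T : ℝ} (hT : ∀ i ∈ Ioc k l, ‖x j - x i‖ ≤ T) :
    ‖x j‖ ≤ (lam + √((l : ℝ) - k)) / ((l : ℝ) - k) + T := by
  have h1 := h.norm_sum_le hk hkl.le hl
  have h2 : (0 : ℝ) < (l : ℝ) - k := by
    have : (k : ℝ) < l := by exact_mod_cast hkl
    linarith
  have hcard : (#(Ioc k l) : ℝ) = (l : ℝ) - k := by
    rw [Nat.card_Ioc, Nat.cast_sub hkl.le]
  have h3 : ((l : ℝ) - k) • x j = ∑ i ∈ Ioc k l, x i + ∑ i ∈ Ioc k l, (x j - x i) := by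
    rw [sum_sub_distrib, sum_const, ← Nat.cast_smul_eq_nsmul ℝ, hcard]; abel
  have h4 : ‖∑ i ∈ Ioc k l, (x j - x i)‖ ≤ ((l : ℝ) - k) * T := by
    rw [← hcard, ← nsmul_eq_mul, ← sum_const]
    exact norm_sum_le_of_le _ hT
  have h5 : ((l : ℝ) - k) * ‖x j‖ ≤ lam + √((l : ℝ) - k) + ((l : ℝ) - k) * T := by
    rw [← Real.norm_of_nonneg h2.le, ← norm_smul, h3, Real.norm_of_nonneg h2.le]
    exact (norm_add_le _ _).trans (add_le_add h1 h4)
  rw [← sub_le_iff_le_add, le_div_iff₀ h2]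
  linarith

/-! ### A priori bound and its improvement in the interior -/

theorem norm_le_ten (h : FusedLassoWindow lam p q x y z) (hlam : 625 ≤ lam)
    (hL : (q : ℝ) - p ≤ lam ^ 2 / 256)
    (hmean : (lam + √((q : ℝ) - p)) / ((q : ℝ) - p) ≤ 7) {j : ℕ} (hj : j ∈ Ioc p q) :
    ‖x j‖ ≤ 10 := by
  rw [mem_Ioc] at hj
  -- Blocks of length one give `δ = 1`; the variation is then below 3, and the mean adds 7.
  have hTV : ∑ e ∈ Icc (p + 1) (q - 1), ‖x (e + 1) - x e‖ ≤ 4 / 3 * (2 * 1 + 1 / (2 * lam)) := by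
    refine h.totalVariation_le hL (by omega) (by omega) zero_le_one ?_ ?_
    · intro e he1 he2 he
      have h1 := h.neg_sqrt_le_sum_inner (k := e - 1) (j := e) (by omega) (by omega) (by omega)
        (h.norm_dual_eq_one (by omega) (by omega) he)
      obtain ⟨e, rfl⟩ : ∃ e', e = e' + 1 := ⟨e - 1, by omega⟩
      simpa using h1
    · intro e he1 he2 he
      have h1 := h.sum_inner_le_sqrt (j := e) (l := e + 1) (by omega) (by omega) (by omega)
        (h.norm_dual_eq_one (by omega) (by omega) he)
      simpa using h1
  have h1 : 1 / (2 * lam) ≤ 1 / (2 * 625) := by gcongr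
  have h2 := h.norm_le_mean_add (k := p) (l := q) (j := j) le_rfl (by omega) le_rfl
    (T := 3) fun i hi => by
      rw [mem_Ioc] at hi
      refine le_trans ?_ (hTV.trans (by linarith))
      rcases le_total i j with hij | hij
      · exact norm_sub_le_sum_Icc x (by omega) hij (by omega)
      · rw [norm_sub_rev]
        exact norm_sub_le_sum_Icc x (by omega) hij (by omega)
  linarith

theorem inner_dual_nonneg (h : FusedLassoWindow lam p q x y z)
    (hx : ∀ j ∈ Ioc p q, ‖x j‖ ≤ 10) {n : ℕ} (hn : 1 ≤ n) (hnlam : 25 * (n : ℝ) ≤ lam) {k l : ℕ}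
    (hk : p ≤ k) (hkl : k ≤ l) (hl : l ≤ q) (hln : l ≤ k + n) (hz : ‖z k‖ = 1 ∨ ‖z l‖ = 1) :
    0 ≤ inner ℝ (z k) (z l) := by
  have hlam := h.lam_pos
  have hlk : (l : ℝ) - k ≤ n := by
    have : (l : ℝ) ≤ k + n := by exact_mod_cast hln
    linarith
  have hn1 : (1 : ℝ) ≤ n := by exact_mod_cast hn
  have h1 : ‖∑ j ∈ Ioc k l, (x j - y j)‖ ≤ 11 * n := by
    rw [sum_sub_distrib]
    refine (norm_sub_le _ _).trans ?_
    have h2 : ‖∑ j ∈ Ioc k l, x j‖ ≤ 10 * n := by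
      refine (norm_sum_le_of_le (f := x) (n := fun _ => 10) _ fun j hj => hx j ?_).trans ?_
      · rw [mem_Ioc] at hj ⊢; omega
      · rw [sum_const, nsmul_eq_mul, Nat.card_Ioc, Nat.cast_sub hkl]; linarith
    have h3 : √((l : ℝ) - k) ≤ n := Real.sqrt_le_iff.2 ⟨by positivity, by nlinarith⟩
    linarith [h.noise_le k l hk hkl hl]
  rw [h.sum_sub hk hkl hl, norm_smul, Real.norm_of_nonneg (by positivity)] at h1
  -- The signal contributes `10 * n` and the noise at most `n`, so the distance is at most `22 /
  -- 25`.
  have h2 : ‖z l - z k‖ ≤ 1 := by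
    by_contra hc
    push Not at hc
    nlinarith
  have h3 := norm_sub_sq_real (z l) (z k)
  have h4 : ‖z l - z k‖ ^ 2 ≤ 1 := by nlinarith [norm_nonneg (z l - z k)]
  rw [real_inner_comm]
  rcases hz with hz | hz <;> rw [hz] at h3
  · nlinarith [sq_nonneg ‖z l‖]
  · nlinarith [sq_nonneg ‖z k‖]

/-- Jumps within `n` steps before `j` make an acute or right angle with `z j`, so `inner ℝ (x i) (z
j)` is largest at `i = j` on that block, and the lower bound `-√n` for the block sum is divided by
`n`. -/
theorem neg_le_inner_left (h : FusedLassoWindow lam p q x y z)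
    (hx : ∀ j ∈ Ioc p q, ‖x j‖ ≤ 10) {n : ℕ} (hn : 1 ≤ n) (hnlam : 25 * (n : ℝ) ≤ lam) {j : ℕ}
    (hpj : p + n ≤ j) (hjq : j < q) (hj : x (j + 1) ≠ x j) :
    -(1 / √n) ≤ inner ℝ (x j) (z j) := by
  have hz := h.norm_dual_eq_one (by omega) hjq hj
  have hmono : ∀ i, j - n < i → i ≤ j → inner ℝ (x i) (z j) ≤ inner ℝ (x j) (z j) := by
    intro i hi hij
    have : ∀ b, i ≤ b → b ≤ j → inner ℝ (x i) (z j) ≤ inner ℝ (x b) (z j) := by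
      intro b hib
      induction b, hib using Nat.le_induction with
      | base => simp
      | succ b hib ih =>
        intro hb
        refine (ih (by omega)).trans ?_
        rw [← sub_nonneg, ← inner_sub_left, h.sub_eq_norm_smul (by omega) (by omega),
          real_inner_smul_left]
        exact mul_nonneg (norm_nonneg _) (h.inner_dual_nonneg hx hn hnlam (by omega) (by omega)
          (by omega) (by omega) (Or.inr hz))
    exact this j hij le_rfl
  have h1 := h.neg_sqrt_le_sum_inner (k := j - n) (j := j) (by omega) (by omega) (by omega) hz
  have h2 : ∑ i ∈ Ioc (j - n) j, inner ℝ (x i) (z j) ≤ n * inner ℝ (x j) (z j) := by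
    refine (sum_le_card_nsmul _ _ (inner ℝ (x j) (z j)) fun i hi => ?_).trans ?_
    · rw [mem_Ioc] at hi
      exact hmono i hi.1 hi.2
    · rw [Nat.card_Ioc, show j - (j - n) = n by omega, nsmul_eq_mul]
  rw [show ((j : ℝ) - (j - n : ℕ)) = n by rw [Nat.cast_sub (by omega)]; ring] at h1
  have hn0 : (0 : ℝ) < n := by exact_mod_cast hn
  have hs : 0 < √(n : ℝ) := Real.sqrt_pos.2 hn0
  rw [← neg_div, div_le_iff₀ hs]
  have h3 := Real.mul_self_sqrt hn0.le
  by_contra hc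
  push Not at hc
  nlinarith

theorem inner_right_le (h : FusedLassoWindow lam p q x y z)
    (hx : ∀ j ∈ Ioc p q, ‖x j‖ ≤ 10) {n : ℕ} (hn : 1 ≤ n) (hnlam : 25 * (n : ℝ) ≤ lam) {j : ℕ}
    (hpj : p < j) (hjq : j + n ≤ q) (hj : x (j + 1) ≠ x j) :
    inner ℝ (x (j + 1)) (z j) ≤ 1 / √n := by
  have hz := h.norm_dual_eq_one hpj (by omega) hj
  have hmono : ∀ b, j + 1 ≤ b → b ≤ j + n →
      inner ℝ (x (j + 1)) (z j) ≤ inner ℝ (x b) (z j) := by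
    intro b hib
    induction b, hib using Nat.le_induction with
    | base => simp
    | succ b hib ih =>
      intro hb
      refine (ih (by omega)).trans ?_
      rw [← sub_nonneg, ← inner_sub_left, h.sub_eq_norm_smul (by omega) (by omega),
        real_inner_smul_left, real_inner_comm]
      exact mul_nonneg (norm_nonneg _) (h.inner_dual_nonneg hx hn hnlam (by omega) (by omega)
        (by omega) (by omega) (Or.inl hz))
  have h1 := h.sum_inner_le_sqrt (j := j) (l := j + n) (by omega) (by omega) (by omega) hz
  have h2 : n * inner ℝ (x (j + 1)) (z j) ≤ ∑ i ∈ Ioc j (j + n), inner ℝ (x i) (z j) := by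
    refine le_trans ?_ (card_nsmul_le_sum _ _ (inner ℝ (x (j + 1)) (z j)) fun i hi => ?_)
    · rw [Nat.card_Ioc, show j + n - j = n by omega, nsmul_eq_mul]
    · rw [mem_Ioc] at hi
      exact hmono i hi.1 hi.2
  rw [show (((j + n : ℕ) : ℝ) - j) = n by push_cast; ring] at h1
  have hn0 : (0 : ℝ) < n := by exact_mod_cast hn
  have hs : 0 < √(n : ℝ) := Real.sqrt_pos.2 hn0
  rw [le_div_iff₀ hs]
  have h3 := Real.mul_self_sqrt hn0.le
  by_contra hc
  push Not at hc
  nlinarith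

/-- The interior estimate: at distance `n` from both ends of a window of length at least `4 * n`,
the minimizer is at most its mean over a central half window plus an oscillation of order `1 / √n`.
-/
theorem norm_le_interior (h : FusedLassoWindow lam p q x y z) (hlam : 625 ≤ lam)
    (hL : (q : ℝ) - p ≤ lam ^ 2 / 256)
    (hmean : (lam + √((q : ℝ) - p)) / ((q : ℝ) - p) ≤ 7) {n i : ℕ} (hn : 1 ≤ n)
    (hnlam : 25 * (n : ℝ) ≤ lam) (hnL : 4 * n + p ≤ q) (hpi : p + n ≤ i) (hiq : i + n ≤ q) :
    ‖x i‖ ≤ 2 * (lam + √(((q : ℝ) - p) / 2)) / ((q : ℝ) - p) + 2.7 / √n := by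
  have hx : ∀ j ∈ Ioc p q, ‖x j‖ ≤ 10 := fun j hj => h.norm_le_ten hlam hL hmean hj
  have hn0 : (0 : ℝ) < n := by exact_mod_cast hn
  have hs : 0 < √(n : ℝ) := Real.sqrt_pos.2 hn0
  have hTV : ∑ e ∈ Icc (p + n) (q - n), ‖x (e + 1) - x e‖ ≤ 2.7 / √n := by
    refine (h.totalVariation_le hL (u := p + n) (v := q - n) (δ := 1 / √n) (by omega) (by omega)
      (by positivity)
      (fun j h1 h2 hj => h.neg_le_inner_left hx hn hnlam h1 (by omega) hj)
      (fun j h1 h2 hj => h.inner_right_le hx hn hnlam (by omega) (by omega) hj)).trans ?_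
    have h1 : √(n : ℝ) ≤ lam / 25 := Real.sqrt_le_iff.2 ⟨by positivity, by nlinarith⟩
    have h2 : 1 / (2 * lam) ≤ 0.02 / √n := by
      rw [div_le_div_iff₀ (by positivity) hs]; linarith
    have h3 : 2.7 / √(n : ℝ) = 4 / 3 * (2 * (1 / √n) + 0.02 / √n) + 0.02 / 1.5 / 2 / √n := by
      field_simp; norm_num
    have h4 : 0 ≤ 0.02 / 1.5 / 2 / √(n : ℝ) := by positivity
    rw [h3]
    linarith
  have h1 := h.norm_le_mean_add (k := p + n) (l := q - n) (j := i) (by omega) (by omega) (by omega)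
    (T := 2.7 / √n) fun j hj => by
      rw [mem_Ioc] at hj
      refine le_trans ?_ hTV
      rcases le_total i j with hij | hij
      · rw [norm_sub_rev]
        exact norm_sub_le_sum_Icc x (by omega) hij (by omega)
      · exact norm_sub_le_sum_Icc x (by omega) hij (by omega)
  refine h1.trans (add_le_add_left ?_ _)
  set D := ((q - n : ℕ) : ℝ) - (p + n : ℕ) with hD
  have hD2 : ((q : ℝ) - p) / 2 ≤ D := by
    rw [hD, Nat.cast_sub (by omega)]
    have : 4 * (n : ℝ) + p ≤ q := by exact_mod_cast hnL
    push_cast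
    linarith
  have hD0 : 0 < ((q : ℝ) - p) / 2 := by
    have : 4 * (n : ℝ) + p ≤ q := by exact_mod_cast hnL
    linarith
  have h5 : ∀ t : ℝ, 0 < t → √t / t = 1 / √t := fun t ht => by
    rw [Real.sqrt_div_self]; simp
  calc (lam + √D) / D = lam / D + 1 / √D := by rw [add_div, h5 D (by linarith)]
    _ ≤ lam / (((q : ℝ) - p) / 2) + 1 / √(((q : ℝ) - p) / 2) := by
        have := Real.sqrt_pos.2 hD0
        gcongr
    _ = 2 * (lam + √(((q : ℝ) - p) / 2)) / ((q : ℝ) - p) := by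
        rw [← h5 _ hD0, ← add_div]
        field_simp

end FusedLassoWindow

/-! ### Choice of scales and the five terms -/

/-- The right hand side of the estimate at the noise level `M = 1`. -/
noncomputable def segmentBound (m i : ℕ) (lam : ℝ) : ℝ :=
  max (4 * (√((m : ℝ) / 2) + lam) / m)
    (max (50 / √m) (max (25 * √5 / √i) (max (25 * √5 / √((m : ℝ) - i)) (125 * √(1 / lam)))))

theorem two_lt_sqrt_five : 2 < √(5 : ℝ) := by
  rw [Real.lt_sqrt (by norm_num)]; norm_num

/-- Each candidate for the minimum `n` is matched with one term of the maximum; the factors 9 and 64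
below absorb the rounding in `m / 4` and `⌊lam / 25⌋₊`. -/
theorem div_sqrt_le_half_segmentBound {m i n : ℕ} {lam : ℝ} (hlam : 625 ≤ lam) (hi : 1 ≤ i)
    (him : i < m) (hm : 4 ≤ m) (hn : n = min (min i (m - i)) (min (m / 4) ⌊lam / 25⌋₊)) :
    2.7 / √n ≤ segmentBound m i lam / 2 := by
  have h5 := two_lt_sqrt_five
  have key : ∀ t : ℝ, 0 < t → ∀ c : ℝ, 0 < c → t ≤ c ^ 2 * n → 2.7 / √(n : ℝ) ≤ 2.7 * c / √t := by
    intro t ht c hc htn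
    have hn0 : (0 : ℝ) < n := by
      by_contra hneg
      push Not at hneg
      nlinarith [sq_nonneg c]
    have h1 : √t ≤ c * √(n : ℝ) := by
      rw [← Real.sqrt_sq hc.le, ← Real.sqrt_mul (sq_nonneg c)]
      exact Real.sqrt_le_sqrt htn
    have h2 := Real.sqrt_pos.2 ht
    have h3 := Real.sqrt_pos.2 hn0
    rw [div_le_div_iff₀ h3 h2]
    nlinarith
  have hi0 : (0 : ℝ) < i := by exact_mod_cast hi
  have hm0 : (0 : ℝ) < m := by exact_mod_cast (by omega : 0 < m)
  have him0 : (0 : ℝ) < (m : ℝ) - i := by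
    have : (i : ℝ) < m := by exact_mod_cast him
    linarith
  have hor : n = i ∨ n = m - i ∨ n = m / 4 ∨ n = ⌊lam / 25⌋₊ := by omega
  unfold segmentBound
  rcases hor with h | h | h | h
  · have h1 : 25 * √5 / √(i : ℝ) ≤ segmentBound m i lam := by simp [segmentBound]
    have h2 := key i hi0 1 one_pos (by rw [h]; linarith)
    have h3 : 2.7 * 1 / √(i : ℝ) ≤ 25 * √5 / √(i : ℝ) / 2 := by
      rw [div_right_comm]; gcongr; linarith
    unfold segmentBound at h1
    linarith
  · have h1 : 25 * √5 / √((m : ℝ) - i) ≤ segmentBound m i lam := by simp [segmentBound]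
    have h2 := key ((m : ℝ) - i) him0 1 one_pos (by rw [h, Nat.cast_sub him.le]; linarith)
    have h3 : 2.7 * 1 / √((m : ℝ) - i) ≤ 25 * √5 / √((m : ℝ) - i) / 2 := by
      rw [div_right_comm]; gcongr; linarith
    unfold segmentBound at h1
    linarith
  · have h1 : 50 / √(m : ℝ) ≤ segmentBound m i lam := by simp [segmentBound]
    have h2 := key m hm0 3 (by norm_num) (by
      have : m ≤ 9 * n := by omega
      have : (m : ℝ) ≤ 9 * n := by exact_mod_cast this
      linarith)
    have h3 : 2.7 * 3 / √(m : ℝ) ≤ 50 / √(m : ℝ) / 2 := by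
      rw [div_right_comm]; gcongr; norm_num
    unfold segmentBound at h1
    linarith
  · have h1 : 125 * √(1 / lam) ≤ segmentBound m i lam := by simp [segmentBound]
    have h2 := key lam (by linarith) 8 (by norm_num) (by
      have := Nat.lt_floor_add_one (lam / 25)
      rw [← h] at this
      linarith)
    have h3 : 2.7 * 8 / √lam ≤ 125 * √(1 / lam) / 2 := by
      rw [Real.sqrt_div zero_le_one, Real.sqrt_one, mul_one_div, div_right_comm]
      gcongr; norm_num
    unfold segmentBound at h1
    linarith

theorem mean_le_of_sq_le {lam D : ℝ} (hlam : 625 ≤ lam) (hD : lam ^ 2 / 600 ≤ D) :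
    2 * (lam + √(D / 2)) / D ≤ 125 * √(1 / lam) / 2 := by
  obtain ⟨r, hr⟩ : ∃ r, r = √lam := ⟨_, rfl⟩
  have hr2 : r ^ 2 = lam := by rw [hr]; exact Real.sq_sqrt (by linarith)
  have hr25 : 25 ≤ r := by
    rw [hr]; exact Real.le_sqrt_of_sq_le (by linarith)
  have hD0 : 0 < D := by nlinarith
  have h2 : lam * r ≤ 24 * D := by
    have : lam * (25 * r) ≤ lam ^ 2 := by
      rw [sq]; refine mul_le_mul_of_nonneg_left ?_ (by linarith); nlinarith
    linarith
  have h3 : √(D / 2) * r ≤ D := by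
    have h4 : √(D / 2) ≤ D / r := by
      refine Real.sqrt_le_iff.2 ⟨by positivity, ?_⟩
      rw [div_pow, hr2, div_le_div_iff₀ two_pos (by linarith)]
      have : lam ≤ 2 * D := by nlinarith
      nlinarith
    rwa [le_div_iff₀ (by linarith)] at h4
  rw [Real.sqrt_div zero_le_one, Real.sqrt_one, ← hr, mul_one_div, div_div,
    div_le_div_iff₀ hD0 (by positivity)]
  linarith

theorem FusedLassoWindow.norm_le_segmentBound {E : Type*} [NormedAddCommGroup E]
    [InnerProductSpace ℝ E] {lam : ℝ} {m : ℕ} {x y z : ℕ → E}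
    (h : FusedLassoWindow lam 0 m x y z) (hlam : 625 ≤ lam) (hupper : lam < 7 * m - √m) {i : ℕ}
    (hi : 1 ≤ i) (him : i < m) : ‖x i‖ ≤ segmentBound m i lam := by
  have hm89 : 89 ≤ m := by
    have : (89 : ℝ) ≤ m := by linarith [Real.sqrt_nonneg (m : ℝ)]
    exact_mod_cast this
  -- A window reaching `H` to each side of `i` has length at most `lam ^ 2 / 256`. After clipping to
  -- the segment it is either the whole segment or has length at least `H`.
  obtain ⟨H, hH⟩ : ∃ H, H = ⌊lam ^ 2 / 512⌋₊ := ⟨_, rfl⟩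
  obtain ⟨N, hN⟩ : ∃ N, N = ⌊lam / 25⌋₊ := ⟨_, rfl⟩
  obtain ⟨n, hn⟩ : ∃ n, n = min (min i (m - i)) (min (m / 4) ⌊lam / 25⌋₊) := ⟨_, rfl⟩
  have hTV := div_sqrt_le_half_segmentBound hlam hi him (by omega) hn
  rw [← hN] at hn
  have hN1 : 1 ≤ N := by
    rw [hN]; exact Nat.le_floor (by push_cast; linarith)
  have hNlam : 25 * (N : ℝ) ≤ lam := by
    have := Nat.floor_le (show 0 ≤ lam / 25 by positivity)
    rw [← hN] at this; linarith
  have hHle : (H : ℝ) ≤ lam ^ 2 / 512 := by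
    rw [hH]; exact Nat.floor_le (by positivity)
  have hHge : lam ^ 2 / 600 ≤ H := by
    have := Nat.lt_floor_add_one (lam ^ 2 / 512)
    rw [← hH] at this
    nlinarith
  have hNH : 4 * N ≤ H := by
    have : (4 : ℝ) * N ≤ H := by nlinarith
    exact_mod_cast this
  obtain ⟨p, hp⟩ : ∃ p, p = i - min i H := ⟨_, rfl⟩
  obtain ⟨q, hq⟩ : ∃ q, q = i + min (m - i) H := ⟨_, rfl⟩
  have hwin := h.mono (p' := p) (q' := q) (by omega) (by omega)
  obtain ⟨D, hD⟩ : ∃ D : ℝ, D = (q : ℝ) - p := ⟨_, rfl⟩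
  have hqp : (q : ℝ) ≤ 2 * H + p := by exact_mod_cast (by omega : q ≤ 2 * H + p)
  have hDcases : D = m ∨ (H : ℝ) ≤ D := by
    by_cases hc : q = m + p
    · left; rw [hD, hc]; push_cast; ring
    · right
      have : H + p ≤ q := by omega
      have : (H : ℝ) + p ≤ q := by exact_mod_cast this
      linarith
  have hmean : (lam + √D) / D ≤ 7 := by
    rcases hDcases with hc | hc
    · have : (0 : ℝ) < m := by exact_mod_cast (by omega : 0 < m)
      rw [hc, div_le_iff₀ this]; linarith
    · have h1 : lam ≤ D := by nlinarith
      have h2 : √D ≤ D := Real.sqrt_le_iff.2 ⟨by linarith, by nlinarith⟩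
      rw [div_le_iff₀ (by linarith)]; linarith
  have hmain : 2 * (lam + √(D / 2)) / D ≤ segmentBound m i lam / 2 := by
    rcases hDcases with hc | hc
    · have h1 : 4 * (√((m : ℝ) / 2) + lam) / m ≤ segmentBound m i lam := by simp [segmentBound]
      have h2 : 2 * (lam + √((m : ℝ) / 2)) / m = 4 * (√((m : ℝ) / 2) + lam) / m / 2 := by ring
      rw [hc, h2]; linarith
    · have h1 : 125 * √(1 / lam) ≤ segmentBound m i lam := by simp [segmentBound]
      refine le_trans ?_ (div_le_div_of_nonneg_right h1 zero_le_two)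
      exact mean_le_of_sq_le hlam (hHge.trans hc)
  have := hwin.norm_le_interior hlam (n := n) (i := i) (by linarith) (by rw [← hD]; exact hmean)
    (by omega) (by
      have : (n : ℝ) ≤ N := by exact_mod_cast (by omega : n ≤ N)
      linarith) (by omega) (by omega) (by omega)
  rw [← hD] at this
  linarith

/-! ### The constant case, rescaling and conclusion -/

theorem eq_of_forall_succ_eq {E : Type*} {x : ℕ → E} {m : ℕ}
    (h : ∀ j, 1 ≤ j → j < m → x (j + 1) = x j) {j : ℕ} (hj : 1 ≤ j) (hjm : j ≤ m) : x j = x 1 := by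
  induction j, hj using Nat.le_induction with
  | base => rfl
  | succ j hj ih => rw [h j hj (by omega), ih (by omega)]

open Finset in
theorem norm_le_of_no_jump {p m : ℕ} {lam M : ℝ} (hM : 0 ≤ M) (hlam : 0 < lam)
    {a b : EuclideanSpace ℝ (Fin p)} {y x : ℕ → EuclideanSpace ℝ (Fin p)}
    (hx : IsSegmentMinimizer m lam a b y x) (hy : ‖∑ j ∈ Ioc 0 m, y j‖ ≤ M * √m)
    (hjump : ∀ j, 1 ≤ j → j < m → x (j + 1) = x j) {i : ℕ} (hi : 1 ≤ i) (him : i ≤ m) :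
    ‖x i‖ ≤ 4 * (M * √((m : ℝ) / 2) + lam) / m := by
  have h1 := hx.norm_sum_sub_le hlam (k := 0) (l := m) (by omega) le_rfl
  have hm : (0 : ℝ) < m := by exact_mod_cast (by omega : 0 < m)
  have h2 : ∑ j ∈ Ioc 0 m, x j = (m : ℝ) • x i := by
    rw [sum_congr rfl (g := fun _ => x i), sum_const, Nat.card_Ioc, Nat.sub_zero,
      Nat.cast_smul_eq_nsmul]
    intro j hj
    rw [mem_Ioc] at hj
    rw [eq_of_forall_succ_eq hjump hj.1 hj.2, eq_of_forall_succ_eq hjump hi him]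
  rw [sum_sub_distrib, h2] at h1
  have h3 : (m : ℝ) * ‖x i‖ ≤ lam + M * √m := by
    have := norm_sub_norm_le ((m : ℝ) • x i) (∑ j ∈ Ioc 0 m, y j)
    rw [norm_smul, Real.norm_of_nonneg hm.le] at this
    linarith
  have h4 : √(m : ℝ) ≤ 2 * √((m : ℝ) / 2) := by
    rw [show (m : ℝ) = 2 * (m / 2) by ring, Real.sqrt_mul zero_le_two, ← show (m : ℝ) = 2 * (m / 2) by ring]
    gcongr
    exact Real.sqrt_le_iff.2 ⟨by norm_num, by norm_num⟩
  rw [le_div_iff₀ hm]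
  have h5 := mul_le_mul_of_nonneg_left h4 hM
  have h6 : 0 ≤ M * √((m : ℝ) / 2) := by positivity
  linarith

theorem mul_segmentBound_div {m i : ℕ} {M lam : ℝ} (hM : 0 < M) :
    M * segmentBound m i (lam / M) =
      max (4 * (M * √((m : ℝ) / 2) + lam) / m) (max (50 * M / √m) (max (25 * √5 * M / √i)
        (max (25 * √5 * M / √((m : ℝ) - i)) (125 * √(M ^ 3 / lam))))) := by
  have h1 : √(M ^ 3 / lam) = M * √(1 / (lam / M)) := by
    rw [show M ^ 3 / lam = M ^ 2 * (1 / (lam / M)) by rw [one_div_div]; ring,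
      Real.sqrt_mul (sq_nonneg M), Real.sqrt_sq hM.le]
  unfold segmentBound
  simp only [mul_max_of_nonneg _ _ hM.le, h1]
  congr 1
  · field_simp
  · congr 1
    · ring
    · congr 1
      · ring
      · congr 1 <;> ring

theorem mainTheorem6 (p m : ℕ) (M lam : ℝ) (a b : EuclideanSpace ℝ (Fin p))
    (y xhat : ℕ → EuclideanSpace ℝ (Fin p))
    (hy : ∀ k l : ℕ, 1 ≤ k → k ≤ l → l ≤ m →
      ‖∑ i ∈ Finset.Icc k l, y i‖ ≤ M * Real.sqrt ((l : ℝ) - (k : ℝ) + 1))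
    (hlam_lower : 25 ^ 2 * M ≤ lam)
    (hlam_upper : lam < (7 * (m : ℝ) - Real.sqrt (m : ℝ)) * M)
    (hxhat : IsSegmentMinimizer m lam a b y xhat)
    (i : ℕ) (hi_lower : 1 ≤ i) (hi_upper : i < m) :
    ‖xhat i‖ ≤
      max (4 * (M * Real.sqrt ((m : ℝ) / 2) + lam) / (m : ℝ))
        (max (50 * M / Real.sqrt (m : ℝ))
          (max (25 * Real.sqrt 5 * M / Real.sqrt (i : ℝ))
            (max (25 * Real.sqrt 5 * M / Real.sqrt ((m : ℝ) - (i : ℝ)))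
              (125 * Real.sqrt (M ^ 3 / lam))))) := by
  have hM0 : 0 ≤ M := by
    have := (norm_nonneg _).trans (hy 1 1 le_rfl le_rfl (by omega))
    simpa using this
  -- For `M = 0` the two bounds on `lam` contradict each other.
  have hM : 0 < M := by
    refine hM0.lt_of_ne fun h0 => ?_
    rw [← h0] at hlam_lower hlam_upper
    linarith
  have hlam : 0 < lam := by linarith
  have hy' : ∀ k l : ℕ, k ≤ l → l ≤ m →
      ‖∑ j ∈ Finset.Ioc k l, y j‖ ≤ M * √((l : ℝ) - k) := by
    intro k l hkl hl
    rcases hkl.eq_or_lt with rfl | hkl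
    · simp
    · have := hy (k + 1) l (by omega) hkl hl
      rw [Finset.Icc_add_one_left_eq_Ioc] at this
      convert this using 3
      push_cast; ring
  -- Normalizing the dual variables needs a jump; a constant minimizer is bounded directly by its
  -- mean.
  by_cases hjump : ∀ j, 1 ≤ j → j < m → xhat (j + 1) = xhat j
  · exact le_max_of_le_left (norm_le_of_no_jump hM.le hlam hxhat
      (by simpa using hy' 0 m (Nat.zero_le m) le_rfl) hjump hi_lower hi_upper.le)
  · push Not at hjump
    obtain ⟨e, he1, hem, he⟩ := hjump
    obtain ⟨z, hz1, hz2, hz3⟩ := hxhat.exists_dual hlam he1 hem he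
    have hwin : FusedLassoWindow (lam / M) 0 m (fun j => M⁻¹ • xhat j) (fun j => M⁻¹ • y j) z :=
      { lam_pos := by positivity
        norm_dual_le := fun j _ hj => hz1 j hj
        sub_eq := fun j _ hj => by
          rw [← smul_sub, hz2 j hj, smul_smul]
          congr 1; field_simp
        inner_jump := fun j hj hjm => by
          rw [← smul_sub, real_inner_smul_left, hz3 j hj hjm, norm_smul,
            Real.norm_of_nonneg (by positivity)]
        noise_le := fun k l _ hkl hl => by
          rw [← Finset.smul_sum, norm_smul, Real.norm_of_nonneg (by positivity),
            inv_mul_le_iff₀ hM]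
          exact hy' k l hkl hl }
    have h1 := hwin.norm_le_segmentBound ((le_div_iff₀ hM).2 (by linarith))
      ((div_lt_iff₀ hM).2 hlam_upper) hi_lower hi_upper
    rw [norm_smul, Real.norm_of_nonneg (by positivity), inv_mul_le_iff₀ hM,
      mul_segmentBound_div hM] at h1
    exact h1
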